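/- Let $n\ge 1$. A randomized mechanism on $\{0,1\}^n$ with outputs in a Borel set $O\subseteq\mathbb R$ is a Markov kernel $M$ from $\{0,1\}^n$ to $O$; $M(X)$ denotes its random output on $X$. Let $\mathrm{ham}$ be the Hamming distance on $\{0,1\}^n$. For $\varepsilon>0$, $M$ is $\varepsilon$-DP if $\mathbb P(M(X)\in S)\le e^{\varepsilon}\,\mathbb P(M(Y)\in S)$ for all measurable $S\subseteq O$ and all $X,Y$ with $\mathrm{ham}(X,Y)\le 1$. For $\rho>0$, $M$ is $\rho$-zCDP if $D_\alpha(M(X)\,\|\,M(Y))\le\rho\alpha$ for all $\alpha\in(1,\infty)$ and all $X,Y$ with $\mathrm{ham}(X,Y)\le 1$, where $D_\alpha(P\|Q)=\frac1{\alpha-1}\ln\int(\frac{dP}{dQ})^{\alpha-1}dP$ if $P\ll Q$ and $D_\alpha(P\|Q)=+\infty$ otherwise. The uniform squared-error risk of $M$ in the Bernoulli model is $$R_n(M)=\sup_{\theta\in(0,1)}\ \mathbb E_{X\sim\mathcal B(\theta)^{\otimes n},\,M}\big[(M(X)-\theta)^2\big],$$ and for a privacy condition $\mathcal C$ ($\varepsilon$-DP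 or $\rho$-zCDP) the private minimax risk $\mathfrak M_n(\mathcal C;O)$ is the infimum of $R_n(M)$ over the mechanisms $M$ with outputs in $O$ that satisfy $\mathcal C$. There is a universal constant $K>0$, and for every $\kappa>0$ a constant $k>0$ depending only on $\kappa$, such that the following hold for every $n\ge1$ and every Borel set $O$ with $(0,1)\subseteq O\subseteq\mathbb R$ (in particular for $O=(0,1)$ and $O=\mathbb R$). 1. ($\varepsilon$-DP.) For every $\varepsilon>0$, $\mathfrak M_n(\varepsilon\text{-DP};O)\le K\max\{\frac1n,\frac1{(n\varepsilon)^2}\}$, and if $n\varepsilon\ge\kappa$ then $\mathfrak M_n(\varepsilon\text{-DP};O)\ge k\max\{\frac1n,\frac1{(n\varepsilon)^2}\}$. Moreover the Laplace mechanism $M(X)=\frac1n\sum_{i=1}^nX_i+\frac1{n\varepsilon}Z$, where $Z$ has density $\frac12e^{-|z|}$, is $\varepsilon$-DP and satisfies $R_n(M)\le K\max\{\frac1n,\frac1{(n\varepsilon)^2}\}$. 2. ($\rho$-zCDP.) For every $\rho>0$, $\mathfrak M_n(\rho\text{-zCDP};O)\le K\max\{\frac1n,\frac1{n^2\rho}\}$,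 and if $n\sqrt\rho\ge\kappa$ then $\mathfrak M_n(\rho\text{-zCDP};O)\ge k\max\{\frac1n,\frac1{n^2\rho}\}$. Moreover the Gaussian mechanism $M(X)=\frac1n\sum_{i=1}^nX_i+\frac2{n\sqrt\rho}Z$, where $Z\sim\mathcal N(0,1)$, is $\rho$-zCDP and satisfies $R_n(M)\le K\max\{\frac1n,\frac1{n^2\rho}\}$. Hence, for parameter sequences with $n\varepsilon_n$ (respectively $n\sqrt{\rho_n}$) bounded away from $0$, the private minimax risks are $\Theta(\max\{\frac1n,\frac1{(n\varepsilon_n)^2}\})$ and $\Theta(\max\{\frac1n,\frac1{n^2\rho_n}\})$, and these rates are attained by the Laplace and the Gaussian mechanism. -/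

import Mathlib

open MeasureTheory ProbabilityTheory
open scoped ENNReal

noncomputable section

namespace PrivateMinimax

/-- Rényi divergence of level `α > 1`:
`(α - 1)⁻¹ * log ∫ (dμ/dν) ^ (α - 1) dμ` if `μ ≪ ν`, and `⊤` otherwise. -/
def renyiDiv {E : Type*} [MeasurableSpace E] (α : ℝ) (μ ν : Measure E) : EReal :=
  open Classical in
  if μ ≪ ν then
    (((α - 1)⁻¹ : ℝ) : EReal) * ENNReal.log (∫⁻ x, (μ.rnDeriv ν x) ^ (α - 1) ∂μ)
  else ⊤

/-- `(ε, δ)`-differential privacy of a randomized mechanism on data sets of size `n`.  A mechanism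
is a Markov kernel from data sets to outputs, `M X` being the law of its output on `X`. -/
def IsDP {n : ℕ} {𝓧 A : Type*} [DecidableEq 𝓧] [MeasurableSpace 𝓧] [MeasurableSpace A]
    (ε δ : ℝ) (M : Kernel (Fin n → 𝓧) A) : Prop :=
  ∀ X Y : Fin n → 𝓧, hammingDist X Y ≤ 1 → ∀ S : Set A, MeasurableSet S →
    M X S ≤ ENNReal.ofReal (Real.exp ε) * M Y S + ENNReal.ofReal δ

/-- `ρ`-zero concentrated differential privacy. -/
def IsZCDP {n : ℕ} {𝓧 A : Type*} [DecidableEq 𝓧] [MeasurableSpace 𝓧] [MeasurableSpace A]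
    (ρ : ℝ) (M : Kernel (Fin n → 𝓧) A) : Prop :=
  ∀ X Y : Fin n → 𝓧, hammingDist X Y ≤ 1 → ∀ α : ℝ, 1 < α →
    renyiDiv α (M X) (M Y) ≤ ((ρ * α : ℝ) : EReal)

/-- The uniform risk over `Θ` of the mechanism `M`, with data laws `P θ` and loss
`Φ (d output θ)`. It takes the value `∞` if the expected loss is infinite or unbounded. -/
def uniformRisk {n : ℕ} {𝓧 A Θ : Type*} [MeasurableSpace 𝓧] [MeasurableSpace A]
    (P : Θ → Measure (Fin n → 𝓧)) (d : A → Θ → ℝ) (Φ : ℝ → ℝ)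
    (M : Kernel (Fin n → 𝓧) A) : ℝ≥0∞ :=
  ⨆ θ : Θ, ∫⁻ X, ∫⁻ a, ENNReal.ofReal (Φ (d a θ)) ∂(M X) ∂(P θ)

/-- The private minimax risk: the infimum of the uniform risk over all randomized mechanisms with
outputs in `A` that satisfy the condition `C`. -/
def privateMinimaxRisk {n : ℕ} {𝓧 A Θ : Type*} [MeasurableSpace 𝓧] [MeasurableSpace A]
    (C : Kernel (Fin n → 𝓧) A → Prop)
    (P : Θ → Measure (Fin n → 𝓧)) (d : A → Θ → ℝ) (Φ : ℝ → ℝ) : ℝ≥0∞ :=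
  ⨅ (M : Kernel (Fin n → 𝓧) A) (_ : IsMarkovKernel M) (_ : C M), uniformRisk P d Φ M

/-- The parameter space `(0, 1)` of the Bernoulli model. -/
abbrev BernoulliParam : Type := Set.Ioo (0 : ℝ) 1

/-- The law of `n` i.i.d. Bernoulli variables with parameter `θ`; `true` stands for the value `1`
and `false` for the value `0`. -/
def bernoulliModel (n : ℕ) (θ : BernoulliParam) : Measure (Fin n → Bool) :=
  Measure.pi fun _ => bernoulliMeasure true false ⟨(θ : ℝ), θ.2.1.le, θ.2.2.le⟩

/-- The private minimax risk for estimating the Bernoulli parameter in squared error from `n`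
samples by mechanisms with values in a set `O` of reals. -/
def bernoulliMinimaxRisk (n : ℕ) (O : Set ℝ) (C : Kernel (Fin n → Bool) O → Prop) : ℝ≥0∞ :=
  privateMinimaxRisk C (bernoulliModel n) (fun a θ => |(a : ℝ) - (θ : ℝ)|) (fun x => x ^ 2)

/-- The worst-case squared error of a real-valued mechanism in the Bernoulli model. -/
def bernoulliRisk (n : ℕ) (M : Kernel (Fin n → Bool) ℝ) : ℝ≥0∞ :=
  uniformRisk (bernoulliModel n) (fun a θ => |a - (θ : ℝ)|) (fun x => x ^ 2) M

/-- The empirical mean `(X₁ + ⋯ + Xₙ) / n`. -/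
def empiricalMean {n : ℕ} (X : Fin n → Bool) : ℝ :=
  (∑ i, if X i then (1 : ℝ) else 0) / n

/-- The mechanism `X ↦ empiricalMean X + s * Z`, where the noise `Z` has law `ν`. -/
def additiveNoise (n : ℕ) (ν : Measure ℝ) (s : ℝ) : Kernel (Fin n → Bool) ℝ where
  toFun X := ν.map fun z => empiricalMean X + s * z
  measurable' := measurable_of_countable _

/-- The standard Laplace distribution `Lap(1)`, with density `x ↦ exp (-|x|) / 2`. -/
def laplaceMeasure : Measure ℝ :=
  volume.withDensity fun x => ENNReal.ofReal (Real.exp (-|x|) / 2)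

/-- The Laplace mechanism: the empirical mean plus `Lap(1) / (n * ε)`. -/
def laplaceMechanism (n : ℕ) (ε : ℝ) : Kernel (Fin n → Bool) ℝ :=
  additiveNoise n laplaceMeasure (1 / (n * ε))

/-- The Gaussian mechanism: the empirical mean plus `2 / (n * √ρ)` times a standard normal. -/
def gaussianMechanism (n : ℕ) (ρ : ℝ) : Kernel (Fin n → Bool) ℝ :=
  additiveNoise n (gaussianReal 0 1) (2 / (n * Real.sqrt ρ))

end PrivateMinimax

end

/-!
The lower bounds come from Le Cam's two point method, `le_uniformRisk_of_two_points`: if no output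
event separates two parameters at distance `Δ`, then the risk is at least of order `Δ ^ 2`. Two
pairs of parameters are used. At distance of order `1 / √n` the data themselves do not separate the
parameters, because the `χ²` divergence of the product laws is bounded
(`expect_sub_le_of_sq_le`). At distance of order `1 / (n * τ)` the outputs do not separate them as
soon as the output law moves by at most `τ` in total variation when one entry of the data changes,
because the probability of an output event then has expectation `n * τ`-Lipschitz in the parameter
(`expect_sub_le_of_bounded_differences`). The condition `n * τ ≥ κ` ensures that this second pair
fits into `(0, 1)`. Pure differential privacy gives `τ = ε` (`IsDP.real_le_add`), and zCDP gives
`τ = 3 * √ρ`, since its Rényi divergence of level `2` controls the `χ²` divergence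
(`real_le_add_of_renyiDiv_two_le`). No group privacy argument is needed.

For the upper bounds, the risk of an additive noise mechanism is at most a constant times the sum
of the variance of the empirical mean and that of the noise. The empirical mean moves by at most
`1 / n` between neighbours, so privacy follows from the effect of a translation on the Laplace
density and from the Rényi divergence of two Gaussians. To reach every output set containing
`(0, 1)`, the output is sent into `(0, 1)` by the map `squeeze`, which differs from the truncation
to `[0, 1]` by at most `1 / n`. This map is strictly increasing, hence a measurable embedding, so
Rényi divergences are unchanged and no data processing inequality is needed (`renyiDiv_map_le`).
-/

namespace PrivateMinimax

/-! ### Expectations in the Bernoulli model -/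

/-- The expectation of `f X` for `n` independent Bernoulli variables `X i` with parameter `θ`,
written as a finite sum. -/
noncomputable def expect (θ : ℝ) {n : ℕ} (f : (Fin n → Bool) → ℝ) : ℝ :=
  ∑ X, (∏ i, if X i then θ else 1 - θ) * f X

theorem expect_zero (θ : ℝ) (f : (Fin 0 → Bool) → ℝ) : expect θ f = f Fin.elim0 := by
  simp only [expect, Finset.univ_eq_empty, Finset.prod_empty, one_mul, Finset.univ_unique,
    Finset.sum_singleton]
  exact congrArg f (Subsingleton.elim _ _)

/-- Conditioning on the first variable. -/
theorem expect_succ (θ : ℝ) {n : ℕ} (f : (Fin (n + 1) → Bool) → ℝ) :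
    expect θ f = θ * expect θ (fun X : Fin n → Bool => f (Fin.cons true X)) +
      (1 - θ) * expect θ (fun X : Fin n → Bool => f (Fin.cons false X)) := by
  unfold expect
  rw [← (Fin.consEquiv fun _ => Bool).sum_comp, Fintype.sum_prod_type, Fintype.sum_bool,
    Finset.mul_sum, Finset.mul_sum]
  simp [Fin.consEquiv, Fin.prod_univ_succ, mul_assoc]

theorem expect_add (θ : ℝ) {n : ℕ} (f g : (Fin n → Bool) → ℝ) :
    expect θ (fun X => f X + g X) = expect θ f + expect θ g := by
  simp [expect, mul_add, Finset.sum_add_distrib]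

theorem expect_const_mul (θ c : ℝ) {n : ℕ} (f : (Fin n → Bool) → ℝ) :
    expect θ (fun X => c * f X) = c * expect θ f := by
  simp [expect, Finset.mul_sum, mul_left_comm]

theorem expect_prod (θ : ℝ) (g : Bool → ℝ) (n : ℕ) :
    expect θ (fun X : Fin n → Bool => ∏ i, g (X i)) =
      (θ * g true + (1 - θ) * g false) ^ n := by
  induction n with
  | zero => simp [expect_zero]
  | succ n ih =>
    rw [expect_succ]
    simp only [Fin.prod_univ_succ, Fin.cons_zero, Fin.cons_succ, expect_const_mul, ih]
    ring

theorem expect_const (θ c : ℝ) (n : ℕ) : expect θ (fun _ : Fin n → Bool => c) = c := by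
  have h1 := expect_prod θ (fun _ => 1) n
  have hc := expect_const_mul θ c fun _ : Fin n → Bool => 1
  simp only [Finset.prod_const_one, mul_one, add_sub_cancel, one_pow] at h1 hc
  rw [hc, h1, mul_one]

theorem weight_nonneg {θ : ℝ} (h0 : 0 ≤ θ) (h1 : θ ≤ 1) {n : ℕ} (X : Fin n → Bool) :
    0 ≤ ∏ i, if X i then θ else 1 - θ :=
  Finset.prod_nonneg fun i _ => by split_ifs <;> linarith

theorem expect_mono {θ : ℝ} (h0 : 0 ≤ θ) (h1 : θ ≤ 1) {n : ℕ} {f g : (Fin n → Bool) → ℝ}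
    (h : ∀ X, f X ≤ g X) : expect θ f ≤ expect θ g :=
  Finset.sum_le_sum fun X _ => mul_le_mul_of_nonneg_left (h X) (weight_nonneg h0 h1 X)

theorem bernoulliModel_singleton {n : ℕ} (θ : BernoulliParam) (X : Fin n → Bool) :
    bernoulliModel n θ {X} = ENNReal.ofReal (∏ i, if X i then (θ : ℝ) else 1 - θ) := by
  rw [bernoulliModel, Measure.pi_singleton, ENNReal.ofReal_prod_of_nonneg]
  · refine Finset.prod_congr rfl fun i _ => ?_
    rw [← ENNReal.ofReal_toReal (measure_ne_top _ {X i}), ← measureReal_def,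
      bernoulliMeasure_real_apply _ (measurableSet_singleton _)]
    cases X i <;> simp
  · intro i _
    have := θ.2.1; have := θ.2.2
    split_ifs <;> linarith

theorem lintegral_bernoulliModel {n : ℕ} (θ : BernoulliParam) {f : (Fin n → Bool) → ℝ}
    (hf : ∀ X, 0 ≤ f X) :
    ∫⁻ X, ENNReal.ofReal (f X) ∂(bernoulliModel n θ) = ENNReal.ofReal (expect θ f) := by
  have hw := weight_nonneg (n := n) θ.2.1.le θ.2.2.le
  rw [lintegral_fintype, expect, ENNReal.ofReal_sum_of_nonneg fun X _ => mul_nonneg (hw X) (hf X)]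
  refine Finset.sum_congr rfl fun X _ => ?_
  rw [bernoulliModel_singleton, mul_comm, ENNReal.ofReal_mul (hw X)]

/-! ### Distinguishing two Bernoulli parameters -/

/-- A function with differences at most `τ` between neighbours has an expectation that is
`n * τ`-Lipschitz in the parameter; the proof exchanges the coordinates one at a time. -/
theorem expect_sub_le_of_bounded_differences {θ₀ θ₁ τ : ℝ} (h0 : 0 ≤ θ₀) (h01 : θ₀ ≤ θ₁)
    (h1 : θ₁ ≤ 1) {n : ℕ} (f : (Fin n → Bool) → ℝ)
    (hf : ∀ X Y, hammingDist X Y ≤ 1 → f X ≤ f Y + τ) :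
    expect θ₁ f - expect θ₀ f ≤ n * τ * (θ₁ - θ₀) := by
  induction n with
  | zero => simp [expect_zero]
  | succ n ih =>
    have hd (b : Bool) (X Y : Fin n → Bool) :
        hammingDist (Fin.cons b X : Fin (n + 1) → Bool) (Fin.cons b Y) = hammingDist X Y := by
      simp [hammingDist, Finset.card_filter, Fin.sum_univ_succ]
    have ht := ih (fun X => f (Fin.cons true X)) fun X Y h => hf _ _ (by rwa [hd])
    have hb := ih (fun X => f (Fin.cons false X)) fun X Y h => hf _ _ (by rwa [hd])
    have hflip : expect θ₀ (fun X : Fin n → Bool => f (Fin.cons true X)) ≤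
        expect θ₀ (fun X : Fin n → Bool => f (Fin.cons false X)) + τ := by
      rw [← expect_const θ₀ τ n, ← expect_add]
      refine expect_mono h0 (h01.trans h1) fun X => hf _ _ ?_
      simp [hammingDist, Finset.card_filter, Fin.sum_univ_succ]
    rw [expect_succ θ₁, expect_succ θ₀]
    have e1 := mul_le_mul_of_nonneg_left ht (h0.trans h01)
    have e2 := mul_le_mul_of_nonneg_left hb (sub_nonneg.2 h1)
    have e3 := mul_le_mul_of_nonneg_left hflip (sub_nonneg.2 h01)
    push_cast
    linarith

/-- A test between the parameters `1 / 2` and `1 / 2 + Δ` is unreliable while `n * Δ ^ 2` is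
small: the likelihood ratio `L` has mean `1` and second moment `(1 + 4 * Δ ^ 2) ^ n` under the
parameter `1 / 2`. -/
theorem expect_sub_le_of_sq_le {Δ : ℝ} {n : ℕ} (hn : n * Δ ^ 2 ≤ 1 / 64)
    (f : (Fin n → Bool) → ℝ) (hf0 : ∀ X, 0 ≤ f X) (hf1 : ∀ X, f X ≤ 1) :
    expect (1 / 2 + Δ) f - expect (1 / 2) f ≤ 1 / 2 := by
  let g : Bool → ℝ := fun b => if b then 1 + 2 * Δ else 1 - 2 * Δ
  let L : (Fin n → Bool) → ℝ := fun X => ∏ i, g (X i)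
  have hL : expect (1 / 2 + Δ) f = expect (1 / 2) fun X => L X * f X := by
    unfold expect
    refine Finset.sum_congr rfl fun X _ => ?_
    rw [← mul_assoc, ← Finset.prod_mul_distrib]
    congr 1
    refine Finset.prod_congr rfl fun i _ => ?_
    cases X i <;> simp [g] <;> ring
  have hL1 : expect (1 / 2) L = 1 := by
    rw [expect_prod]
    simp only [g]
    norm_num
    ring_nf
  have hL2 : expect (1 / 2) (fun X : Fin n → Bool => ∏ i, g (X i) ^ 2) ≤ 5 / 4 := by
    rw [expect_prod (1 / 2) fun b => g b ^ 2]
    have e : (1 / 2 * g true ^ 2 + (1 - 1 / 2) * g false ^ 2 : ℝ) = 4 * Δ ^ 2 + 1 := by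
      simp [g]; ring
    rw [e]
    calc (4 * Δ ^ 2 + 1) ^ n ≤ Real.exp (4 * Δ ^ 2) ^ n :=
          pow_le_pow_left₀ (by positivity) (Real.add_one_le_exp _) _
      _ = Real.exp (4 * (n * Δ ^ 2)) := by rw [← Real.exp_nat_mul]; ring_nf
      _ ≤ Real.exp (1 / 16) := Real.exp_le_exp.2 (by linarith)
      _ ≤ 1 / (1 - 1 / 16) := Real.exp_bound_div_one_sub_of_interval (by norm_num) (by norm_num)
      _ ≤ 5 / 4 := by norm_num
  -- the inequality `(L - 1) * f ≤ 1 / 4 + (L - 1) ^ 2` takes the place of Cauchy-Schwarz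
  have key : expect (1 / 2) (fun X => L X * f X) ≤
      expect (1 / 2) fun X => (f X + 5 / 4) + ((∏ i, g (X i) ^ 2) + (-2) * L X) := by
    refine expect_mono (by norm_num) (by norm_num) fun X => ?_
    rw [Finset.prod_pow]
    change L X * f X ≤ (f X + 5 / 4) + (L X ^ 2 + (-2) * L X)
    nlinarith [sq_nonneg (L X - 1 - f X / 2), hf0 X, hf1 X]
  rw [expect_add, expect_add, expect_add, expect_const, expect_const_mul, hL1] at key
  linarith

/-! ### Lower bounds for the minimax risk -/

/-- **Le Cam's two point method**: if no event of the output separates two parameters, then the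
risk is at least of the order of their squared distance. -/
theorem le_uniformRisk_of_two_points {n : ℕ} {O : Set ℝ} (M : Kernel (Fin n → Bool) O)
    [IsMarkovKernel M] (θ₀ θ₁ : BernoulliParam) (h01 : (θ₀ : ℝ) ≤ θ₁)
    (h : ∀ S : Set O, MeasurableSet S →
      expect θ₁ (fun X => (M X).real S) - expect θ₀ (fun X => (M X).real S) ≤ 1 / 2) :
    ENNReal.ofReal (((θ₁ : ℝ) - θ₀) ^ 2 / 16) ≤
      uniformRisk (bernoulliModel n) (fun (a : O) θ => |(a : ℝ) - (θ : ℝ)|) (fun x => x ^ 2) M := by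
  set D : ℝ := (θ₁ : ℝ) - θ₀ with hD
  have hD0 : 0 ≤ D := sub_nonneg.2 h01
  -- the test that decides for the nearer of the two parameters
  let S : Set O := {a | (θ₀ : ℝ) + D / 2 ≤ a}
  have hS : MeasurableSet S := measurableSet_le measurable_const measurable_subtype_coe
  have bound (θ : BernoulliParam) (T : Set O) (hT : MeasurableSet T)
      (hdist : ∀ a ∈ T, D / 2 ≤ |(a : ℝ) - θ|) :
      ENNReal.ofReal (D ^ 2 / 4 * expect θ fun X => (M X).real T) ≤
        uniformRisk (bernoulliModel n) (fun (a : O) θ => |(a : ℝ) - (θ : ℝ)|)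
          (fun x => x ^ 2) M := by
    refine le_trans ?_ (le_iSup _ θ)
    rw [← expect_const_mul, ← lintegral_bernoulliModel θ fun X => by positivity]
    refine lintegral_mono fun X => ?_
    rw [ENNReal.ofReal_mul (by positivity), ofReal_measureReal, ← setLIntegral_const]
    refine (setLIntegral_mono' hT fun a ha => ENNReal.ofReal_le_ofReal ?_).trans
      (setLIntegral_le_lintegral T _)
    have := pow_le_pow_left₀ (by positivity) (hdist a ha) 2
    dsimp only
    linarith
  have b0 := bound θ₀ S hS fun a (ha : (θ₀ : ℝ) + D / 2 ≤ a) => by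
    rw [abs_of_nonneg (by linarith)]; linarith
  have b1 := bound θ₁ Sᶜ hS.compl fun a ha => by
    have ha : (a : ℝ) < θ₀ + D / 2 := not_le.1 ha
    rw [abs_of_nonpos (by linarith)]; linarith
  have hc : expect (θ₁ : ℝ) (fun X => (M X).real Sᶜ) =
      1 - expect (θ₁ : ℝ) fun X => (M X).real S := by
    have e : (fun X => (M X).real Sᶜ) = fun X => 1 + (-1) * (M X).real S := by
      funext X
      rw [probReal_compl_eq_one_sub hS]
      ring
    rw [e, expect_add, expect_const, expect_const_mul]
    ring
  have hTV := h S hS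
  rcases le_total (1 / 4) (expect (θ₀ : ℝ) fun X => (M X).real S) with h4 | h4
  · refine le_trans (ENNReal.ofReal_le_ofReal ?_) b0
    nlinarith [sq_nonneg D]
  · refine le_trans (ENNReal.ofReal_le_ofReal ?_) b1
    rw [hc]
    nlinarith [sq_nonneg D]

/-- The lower bound for mechanisms whose output law changes by at most `τ` in total variation
between neighbouring data sets. The rate `1 / n` is the sampling error; the rate
`1 / (n * τ) ^ 2` is the price of the stability. -/
theorem le_uniformRisk_of_stable {n : ℕ} (hn : 1 ≤ n) {κ τ : ℝ} (hκ : 0 < κ) (hτ : 0 < τ)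
    (hκτ : κ ≤ n * τ) {O : Set ℝ} (M : Kernel (Fin n → Bool) O) [IsMarkovKernel M]
    (hM : ∀ X Y, hammingDist X Y ≤ 1 → ∀ S : Set O, MeasurableSet S →
      (M X).real S ≤ (M Y).real S + τ) :
    ENNReal.ofReal (min (1 / 1024) (min (1 / 2) (κ / 4) ^ 2 / 16) *
        max (1 / (n : ℝ)) (1 / (n * τ) ^ 2)) ≤
      uniformRisk (bernoulliModel n) (fun (a : O) θ => |(a : ℝ) - (θ : ℝ)|)
        (fun x => x ^ 2) M := by
  have hn1 : (1 : ℝ) ≤ n := by exact_mod_cast hn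
  have two_points (Δ : ℝ) (h0 : 0 ≤ Δ) (h4 : Δ ≤ 1 / 4)
      (h : ∀ S : Set O, MeasurableSet S → expect (1 / 2 + Δ) (fun X => (M X).real S) -
        expect (1 / 2) (fun X => (M X).real S) ≤ 1 / 2) :
      ENNReal.ofReal (Δ ^ 2 / 16) ≤ uniformRisk (bernoulliModel n)
        (fun (a : O) θ => |(a : ℝ) - (θ : ℝ)|) (fun x => x ^ 2) M := by
    have := le_uniformRisk_of_two_points M ⟨1 / 2, by norm_num, by norm_num⟩
      ⟨1 / 2 + Δ, by linarith, by linarith⟩ (by simpa using h0) h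
    simpa using this
  rw [mul_max_of_nonneg _ _ (by positivity), ENNReal.ofReal_max]
  refine max_le ?_ ?_
  · -- the distance `Δ = 1 / (8 * √n)` has `n * Δ ^ 2 = 1 / 64` and `Δ ^ 2 / 16 = 1 / (1024 * n)`
    have hsq : (1 / (8 * √(n : ℝ))) ^ 2 = 1 / (64 * n) := by
      rw [div_pow, mul_pow, Real.sq_sqrt (by positivity)]; norm_num
    have := two_points (1 / (8 * √(n : ℝ))) (by positivity) ?_ fun S _ => ?_
    · refine le_trans (ENNReal.ofReal_le_ofReal ?_) this
      rw [hsq]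
      calc _ ≤ 1 / 1024 * (1 / (n : ℝ)) := by gcongr; exact min_le_left _ _
        _ = _ := by field_simp; norm_num
    · have : (1 : ℝ) ≤ √(n : ℝ) := Real.one_le_sqrt.2 hn1
      rw [div_le_div_iff₀ (by positivity) (by norm_num)]
      linarith
    · refine expect_sub_le_of_sq_le ?_ _ (fun X => measureReal_nonneg)
        fun X => measureReal_le_one
      rw [hsq]
      apply le_of_eq
      field_simp
  · -- the distance `c / (n * τ)` moves event probabilities by at most `c ≤ 1 / 2`, and it is at
    -- most `1 / 4`, which keeps the second parameter inside `(0, 1)`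
    set c := min (1 / 2) (κ / 4) with hc
    have hc0 : 0 < c := by positivity
    have hnτ : 0 < n * τ := hκ.trans_le hκτ
    have h4 : c / (n * τ) ≤ 1 / 4 := by
      rw [div_le_iff₀ hnτ]
      linarith [min_le_right (1 / 2) (κ / 4)]
    have := two_points (c / (n * τ)) (by positivity) h4 fun S hS => ?_
    · refine le_trans (ENNReal.ofReal_le_ofReal ?_) this
      calc _ ≤ c ^ 2 / 16 * (1 / (n * τ) ^ 2) := by gcongr; exact min_le_right _ _
        _ = _ := by field_simp
    · refine (expect_sub_le_of_bounded_differences (τ := τ) (by norm_num)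
        (by linarith [div_pos hc0 hnτ]) (by linarith) _ fun X Y h => hM X Y h S hS).trans ?_
      rw [add_sub_cancel_left, mul_div_cancel₀ _ hnτ.ne']
      exact min_le_left _ _

/-- Neighbouring outputs of an `ε`-differentially private mechanism are `ε`-close in total
variation. -/
theorem IsDP.real_le_add {n : ℕ} {A : Type*} [MeasurableSpace A] {ε : ℝ} (hε : 0 ≤ ε)
    {M : Kernel (Fin n → Bool) A} [IsMarkovKernel M] (hM : IsDP ε 0 M) (X Y : Fin n → Bool)
    (hXY : hammingDist X Y ≤ 1) (S : Set A) (hS : MeasurableSet S) :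
    (M X).real S ≤ (M Y).real S + ε := by
  -- on the complement the privacy bound reads `1 - M X S ≥ exp (-ε) * (1 - M Y S)`
  have h := hM Y X (by rwa [hammingDist_comm]) Sᶜ hS.compl
  have h' := ENNReal.toReal_mono (by finiteness) h
  rw [ENNReal.ofReal_zero, add_zero, ENNReal.toReal_mul,
    ENNReal.toReal_ofReal (Real.exp_pos _).le] at h'
  change (M Y).real Sᶜ ≤ Real.exp ε * (M X).real Sᶜ at h'
  rw [probReal_compl_eq_one_sub hS, probReal_compl_eq_one_sub hS] at h'
  have h1 : (M X).real S ≤ 1 := measureReal_le_one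
  have h2 : (0 : ℝ) ≤ (M Y).real S := measureReal_nonneg
  have h3 : Real.exp (-ε) * (1 - (M Y).real S) ≤ 1 - (M X).real S := by
    have := mul_le_mul_of_nonneg_left h' (Real.exp_pos (-ε)).le
    rwa [← mul_assoc, ← Real.exp_add, neg_add_cancel, Real.exp_zero, one_mul] at this
  nlinarith [Real.add_one_le_exp (-ε), (measureReal_le_one : (M Y).real S ≤ 1)]

/-- A Rényi divergence of level `2` that is at most `2 * ρ` bounds the total variation by
`3 * √ρ`, through the `χ²` divergence. -/
theorem real_le_add_of_renyiDiv_two_le {E : Type*} [MeasurableSpace E] {μ ν : Measure E}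
    [IsProbabilityMeasure μ] [IsProbabilityMeasure ν] {ρ : ℝ} (hρ : 0 < ρ)
    (h : renyiDiv 2 μ ν ≤ ((ρ * 2 : ℝ) : EReal)) {S : Set E} (hS : MeasurableSet S) :
    μ.real S ≤ ν.real S + 3 * √ρ := by
  -- for `ρ ≥ 1 / 9` the right-hand side is at least `1`
  rcases le_total (1 / 9) ρ with h9 | h9
  · have : 1 / 3 ≤ √ρ := Real.le_sqrt_of_sq_le (by linarith)
    linarith [(measureReal_le_one : μ.real S ≤ 1), (measureReal_nonneg : 0 ≤ ν.real S)]
  unfold renyiDiv at h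
  split_ifs at h with hac
  swap
  · exact absurd (top_le_iff.1 h) (EReal.coe_ne_top _)
  set r := μ.rnDeriv ν with hr
  have hrm : Measurable r := Measure.measurable_rnDeriv μ ν
  have hsq : ∫⁻ x, r x ^ 2 ∂ν ≤ ENNReal.ofReal (Real.exp (2 * ρ)) := by
    have e : ∫⁻ x, r x ^ (2 - 1 : ℝ) ∂μ = ∫⁻ x, r x ^ 2 ∂ν := by
      rw [← lintegral_rnDeriv_mul hac (by fun_prop)]
      refine lintegral_congr fun x => ?_
      norm_num [sq]
      rfl
    rw [e] at h
    rw [← ENNReal.log_le_log_iff, ENNReal.log_ofReal_of_pos (Real.exp_pos _), Real.log_exp]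
    rw [mul_comm 2 ρ]
    norm_num at h ⊢
    exact h
  have hset (T : Set E) : ∫⁻ x in T, r x ∂ν = μ T := Measure.setLIntegral_rnDeriv hac T
  -- pointwise, `2 * s * r ≤ s ^ 2 + r ^ 2`, with `s = 1 + √ρ` on `S` and `s = 1` off `S`
  have young (s : ℝ) (hs : 0 ≤ s) (T : Set E) :
      ENNReal.ofReal (2 * s) * μ T ≤
        ENNReal.ofReal (s ^ 2) * ν T + ∫⁻ x in T, r x ^ 2 ∂ν := by
    rw [← hset, ← lintegral_const_mul _ hrm, ← setLIntegral_const,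
      ← lintegral_add_left measurable_const]
    refine lintegral_mono fun x => ?_
    rcases eq_or_ne (r x) ⊤ with ht | ht
    · simp [ht]
    · rw [← ENNReal.ofReal_toReal ht, ← ENNReal.ofReal_mul (by positivity),
        ← ENNReal.ofReal_pow ENNReal.toReal_nonneg,
        ← ENNReal.ofReal_add (by positivity) (by positivity)]
      exact ENNReal.ofReal_le_ofReal (by nlinarith [sq_nonneg (s - (r x).toReal)])
  have total := add_le_add (young (1 + √ρ) (by positivity) S) (young 1 (by norm_num) Sᶜ)
  rw [add_add_add_comm, lintegral_add_compl _ hS] at total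
  replace total := total.trans (add_le_add_right hsq _)
  replace total := ENNReal.toReal_mono (by finiteness) total
  rw [ENNReal.toReal_add (by finiteness) (by finiteness),
    ENNReal.toReal_add (by finiteness) (by finiteness),
    ENNReal.toReal_add (by finiteness) (by finiteness)] at total
  simp only [ENNReal.toReal_mul] at total
  rw [ENNReal.toReal_ofReal (by positivity), ENNReal.toReal_ofReal (by positivity),
    ENNReal.toReal_ofReal (by positivity), ENNReal.toReal_ofReal (by positivity),
    ENNReal.toReal_ofReal (by positivity)] at total
  simp only [← measureReal_def] at total
  rw [probReal_compl_eq_one_sub hS, probReal_compl_eq_one_sub hS] at total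
  have hexp : Real.exp (2 * ρ) ≤ 1 + 3 * ρ := by
    refine (Real.exp_bound_div_one_sub_of_interval (by linarith) (by linarith)).trans ?_
    rw [div_le_iff₀ (by linarith)]
    nlinarith
  have hs : √ρ ^ 2 = ρ := Real.sq_sqrt hρ.le
  have hs0 : 0 < √ρ := Real.sqrt_pos.2 hρ
  have hν1 : ν.real S ≤ 1 := measureReal_le_one
  refine le_of_mul_le_mul_left ?_ (mul_pos two_pos hs0)
  nlinarith

/-! ### The risk of additive noise -/

theorem expect_sq_add_sum (θ c : ℝ) (n : ℕ) :
    expect θ (fun X : Fin n → Bool => (c + ∑ i, ((if X i then (1 : ℝ) else 0) - θ)) ^ 2) =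
      c ^ 2 + n * (θ * (1 - θ)) := by
  induction n generalizing c with
  | zero => simp [expect_zero]
  | succ n ih =>
    rw [expect_succ]
    simp only [Fin.sum_univ_succ, Fin.cons_zero, Fin.cons_succ, ← add_assoc, ih]
    push_cast
    simp
    ring

/-- The variance of the empirical mean. -/
theorem expect_sq_empiricalMean_sub (θ : ℝ) {n : ℕ} (hn : n ≠ 0) :
    expect θ (fun X : Fin n → Bool => (empiricalMean X - θ) ^ 2) = θ * (1 - θ) / n := by
  have hn' : (n : ℝ) ≠ 0 := by exact_mod_cast hn
  have e (X : Fin n → Bool) : (empiricalMean X - θ) ^ 2 =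
      (1 / (n : ℝ)) ^ 2 * (0 + ∑ i, ((if X i then (1 : ℝ) else 0) - θ)) ^ 2 := by
    rw [empiricalMean, Finset.sum_sub_distrib]
    simp only [Finset.sum_const, Finset.card_univ, Fintype.card_fin, nsmul_eq_mul]
    field_simp
    ring
  simp only [e, expect_const_mul, expect_sq_add_sum]
  field_simp
  ring

theorem additiveNoise_apply (n : ℕ) (ν : Measure ℝ) (s : ℝ) (X : Fin n → Bool) :
    additiveNoise n ν s X = ν.map fun z => empiricalMean X + s * z :=
  rfl

instance isMarkovKernel_additiveNoise (n : ℕ) (ν : Measure ℝ) [IsProbabilityMeasure ν] (s : ℝ) :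
    IsMarkovKernel (additiveNoise n ν s) where
  isProbabilityMeasure X := by
    rw [additiveNoise_apply]
    exact Measure.isProbabilityMeasure_map (by fun_prop)

/-- The risk of an additive noise mechanism whose output is post-processed by a map `φ` that loses
at most `η` in the distance to the parameter. -/
theorem uniformRisk_map_additiveNoise_le {n : ℕ} (hn : n ≠ 0) {ν : Measure ℝ}
    [IsProbabilityMeasure ν] {v : ℝ} (hv : 0 ≤ v)
    (hν : ∫⁻ z, ENNReal.ofReal (z ^ 2) ∂ν ≤ ENNReal.ofReal v) (s : ℝ)
    {A : Type*} [MeasurableSpace A] {d : A → BernoulliParam → ℝ} (hd : ∀ a θ, 0 ≤ d a θ)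
    {φ : ℝ → A} (hφ : Measurable φ) {η : ℝ} (hη : ∀ x (θ : BernoulliParam),
      d (φ x) θ ≤ |x - θ| + η) :
    uniformRisk (bernoulliModel n) d (fun x => x ^ 2) ((additiveNoise n ν s).map φ) ≤
      ENNReal.ofReal (1 / n + 4 * s ^ 2 * v + 2 * η ^ 2) := by
  refine iSup_le fun θ => ?_
  have hn' : (0 : ℝ) < n := by exact_mod_cast Nat.pos_of_ne_zero hn
  have inner (X : Fin n → Bool) :
      ∫⁻ a, ENNReal.ofReal (d a θ ^ 2) ∂((additiveNoise n ν s).map φ X) ≤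
        ENNReal.ofReal (4 * (empiricalMean X - θ) ^ 2 + (4 * s ^ 2 * v + 2 * η ^ 2)) := by
    rw [Kernel.map_apply _ hφ, additiveNoise_apply, Measure.map_map hφ (by fun_prop)]
    calc ∫⁻ a, ENNReal.ofReal (d a θ ^ 2) ∂(ν.map (φ ∘ fun z => empiricalMean X + s * z))
        ≤ ∫⁻ z, ENNReal.ofReal (d (φ (empiricalMean X + s * z)) θ ^ 2) ∂ν :=
          lintegral_map_le _ _
      _ ≤ ∫⁻ z, (ENNReal.ofReal (4 * (empiricalMean X - θ) ^ 2 + 2 * η ^ 2) +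
            ENNReal.ofReal (4 * s ^ 2) * ENNReal.ofReal (z ^ 2)) ∂ν := by
          refine lintegral_mono fun z => ?_
          rw [← ENNReal.ofReal_mul (by positivity),
            ← ENNReal.ofReal_add (by positivity) (by positivity)]
          refine ENNReal.ofReal_le_ofReal ?_
          have h1 := pow_le_pow_left₀ (hd _ _) (hη (empiricalMean X + s * z) θ) 2
          have h2 := sq_abs (empiricalMean X + s * z - θ)
          nlinarith [sq_nonneg (|empiricalMean X + s * z - θ| - η),
            sq_nonneg (empiricalMean X - θ - s * z)]
      _ = ENNReal.ofReal (4 * (empiricalMean X - θ) ^ 2 + 2 * η ^ 2) +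
            ENNReal.ofReal (4 * s ^ 2) * ∫⁻ z, ENNReal.ofReal (z ^ 2) ∂ν := by
          rw [lintegral_add_left measurable_const, lintegral_const, measure_univ, mul_one,
            lintegral_const_mul _ (by fun_prop)]
      _ ≤ ENNReal.ofReal (4 * (empiricalMean X - θ) ^ 2 + 2 * η ^ 2) +
            ENNReal.ofReal (4 * s ^ 2) * ENNReal.ofReal v := by gcongr
      _ = _ := by
          rw [← ENNReal.ofReal_mul (by positivity),
            ← ENNReal.ofReal_add (by positivity) (by positivity)]
          congr 1
          ring
  refine (lintegral_mono inner).trans ?_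
  rw [lintegral_bernoulliModel θ fun X => by positivity, expect_add, expect_const_mul,
    expect_const, expect_sq_empiricalMean_sub _ hn]
  refine ENNReal.ofReal_le_ofReal ?_
  have : 4 * ((θ : ℝ) * (1 - θ) / n) ≤ 1 / n := by
    rw [← mul_div_assoc]
    gcongr
    nlinarith [sq_nonneg (2 * (θ : ℝ) - 1)]
  linarith

theorem bernoulliRisk_additiveNoise_le {n : ℕ} (hn : n ≠ 0) {ν : Measure ℝ}
    [IsProbabilityMeasure ν] {v : ℝ} (hv : 0 ≤ v)
    (hν : ∫⁻ z, ENNReal.ofReal (z ^ 2) ∂ν ≤ ENNReal.ofReal v) (s : ℝ) :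
    bernoulliRisk n (additiveNoise n ν s) ≤ ENNReal.ofReal (1 / n + 4 * s ^ 2 * v) := by
  have h := uniformRisk_map_additiveNoise_le hn hv hν s (d := fun (a : ℝ) θ => |a - (θ : ℝ)|)
    (fun _ _ => abs_nonneg _) (φ := id) measurable_id (η := 0) (by simp)
  simpa [bernoulliRisk, Kernel.map_id] using h

/-! ### Moving real outputs into a prescribed output set -/

/-- A strictly increasing map from the line into `(0, 1)` that is `η`-close to the truncation to
`[0, 1]`. Being injective, it does not change Rényi divergences. -/
noncomputable def squeeze (η x : ℝ) : ℝ :=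
  (1 - η) * max 0 (min x 1) + η * Real.sigmoid x

theorem squeeze_strictMono {η : ℝ} (h0 : 0 < η) (h1 : η ≤ 1) : StrictMono (squeeze η) := by
  intro x y hxy
  have hm : max 0 (min x 1) ≤ max 0 (min y 1) := max_le_max le_rfl (min_le_min hxy.le le_rfl)
  exact add_lt_add_of_le_of_lt (mul_le_mul_of_nonneg_left hm (by linarith))
    (mul_lt_mul_of_pos_left (Real.sigmoid_strictMono hxy) h0)

theorem squeeze_mem_Ioo {η : ℝ} (h0 : 0 < η) (h1 : η ≤ 1) (x : ℝ) :
    squeeze η x ∈ Set.Ioo 0 1 := by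
  have a : 0 ≤ (1 - η) * max 0 (min x 1) :=
    mul_nonneg (by linarith) (le_max_left _ _)
  have b : (1 - η) * max 0 (min x 1) ≤ (1 - η) * 1 :=
    mul_le_mul_of_nonneg_left (max_le zero_le_one (min_le_right _ _)) (by linarith)
  have c := mul_pos h0 (Real.sigmoid_pos x)
  have d := mul_lt_mul_of_pos_left (Real.sigmoid_lt_one x) h0
  unfold squeeze
  constructor <;> linarith

theorem continuous_squeeze (η : ℝ) : Continuous (squeeze η) := by
  have := continuous_sigmoid
  unfold squeeze
  fun_prop

theorem abs_squeeze_sub_le {η : ℝ} (h0 : 0 < η) (x : ℝ) (θ : BernoulliParam) :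
    |squeeze η x - θ| ≤ |x - θ| + η := by
  have ht0 := θ.2.1
  have ht1 := θ.2.2
  set c := max 0 (min x 1) with hc
  have hc0 : 0 ≤ c := le_max_left _ _
  have hc1 : c ≤ 1 := max_le zero_le_one (min_le_right _ _)
  have hcx : |c - θ| ≤ |x - θ| := by
    have := abs_max_sub_max_le_abs (min x 1) θ 0
    have h' := abs_inf_sub_inf_le_abs x θ 1
    rw [max_eq_left ht0.le, max_comm] at this
    rw [min_eq_left ht1.le] at h'
    exact this.trans h'
  have hs0 := Real.sigmoid_pos x
  have hs1 := Real.sigmoid_lt_one x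
  have hd : |η * (Real.sigmoid x - c)| ≤ η := by
    rw [abs_mul, abs_of_pos h0]
    exact mul_le_of_le_one_right h0.le (abs_le.2 ⟨by linarith, by linarith⟩)
  have e : squeeze η x - θ = (c - θ) + η * (Real.sigmoid x - c) := by
    rw [squeeze, ← hc]
    ring
  rw [e]
  exact (abs_add_le _ _).trans (add_le_add hcx hd)

theorem IsDP.map {n : ℕ} {A B : Type*} [MeasurableSpace A] [MeasurableSpace B] {ε δ : ℝ}
    {M : Kernel (Fin n → Bool) A} (hM : IsDP ε δ M) {φ : A → B} (hφ : Measurable φ) :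
    IsDP ε δ (M.map φ) := fun X Y h S hS => by
  rw [Kernel.map_apply' _ hφ _ hS, Kernel.map_apply' _ hφ _ hS]
  exact hM X Y h _ (hφ hS)

theorem renyiDiv_map_le {E F : Type*} [MeasurableSpace E] [MeasurableSpace F] (α : ℝ)
    (μ ν : Measure E) [SigmaFinite μ] [SigmaFinite ν] {φ : E → F} (hφ : MeasurableEmbedding φ) :
    renyiDiv α (μ.map φ) (ν.map φ) ≤ renyiDiv α μ ν := by
  by_cases hac : μ ≪ ν
  · rw [renyiDiv, renyiDiv, if_pos hac, if_pos (hφ.absolutelyContinuous_map hac),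
      hφ.lintegral_map]
    refine le_of_eq ?_
    congr 2
    refine lintegral_congr_ae ?_
    filter_upwards [hac.ae_eq (hφ.rnDeriv_map μ ν)] with x hx
    rw [hx]
  · rw [renyiDiv.eq_def α μ ν, if_neg hac]
    exact le_top

theorem IsZCDP.map {n : ℕ} {A B : Type*} [MeasurableSpace A] [MeasurableSpace B] {ρ : ℝ}
    {M : Kernel (Fin n → Bool) A} [IsMarkovKernel M] (hM : IsZCDP ρ M) {φ : A → B}
    (hφ : MeasurableEmbedding φ) : IsZCDP ρ (M.map φ) := fun X Y h α hα => by
  rw [Kernel.map_apply _ hφ.measurable, Kernel.map_apply _ hφ.measurable]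
  exact (renyiDiv_map_le α _ _ hφ).trans (hM X Y h α hα)

/-- A private additive noise mechanism with real outputs bounds the minimax risk over every output
set containing `(0, 1)`, at an extra cost of at most `2 / n`. -/
theorem bernoulliMinimaxRisk_le {n : ℕ} (hn : 1 ≤ n) {ν : Measure ℝ}
    [IsProbabilityMeasure ν] {v : ℝ} (hv : 0 ≤ v)
    (hν : ∫⁻ z, ENNReal.ofReal (z ^ 2) ∂ν ≤ ENNReal.ofReal v) (s : ℝ) {O : Set ℝ}
    (hO : Set.Ioo 0 1 ⊆ O) (C : Kernel (Fin n → Bool) O → Prop)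
    (hC : ∀ φ : ℝ → O, MeasurableEmbedding φ → C ((additiveNoise n ν s).map φ)) :
    bernoulliMinimaxRisk n O C ≤ ENNReal.ofReal (3 / n + 4 * s ^ 2 * v) := by
  have hn1 : (1 : ℝ) ≤ n := by exact_mod_cast hn
  have h0 : 0 < 1 / (n : ℝ) := by positivity
  have h1 : 1 / (n : ℝ) ≤ 1 := by rw [div_le_one (by positivity)]; exact hn1
  let φ : ℝ → O := fun x => ⟨squeeze (1 / n) x, hO (squeeze_mem_Ioo h0 h1 x)⟩
  have hφm : Measurable φ := (continuous_squeeze _).measurable.subtype_mk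
  have hφ : MeasurableEmbedding φ := hφm.measurableEmbedding fun x y hxy =>
    (squeeze_strictMono h0 h1).injective (congrArg Subtype.val hxy)
  have hmk : IsMarkovKernel ((additiveNoise n ν s).map φ) :=
    Kernel.IsMarkovKernel.map _ hφm
  have hle : bernoulliMinimaxRisk n O C ≤ uniformRisk (bernoulliModel n)
      (fun (a : O) θ => |(a : ℝ) - (θ : ℝ)|) (fun x => x ^ 2) ((additiveNoise n ν s).map φ) :=
    (iInf_le _ _).trans ((iInf_le _ hmk).trans (iInf_le _ (hC φ hφ)))
  refine hle.trans ?_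
  refine (uniformRisk_map_additiveNoise_le (by omega) hv hν s
    (d := fun (a : O) θ => |(a : ℝ) - (θ : ℝ)|) (fun _ _ => abs_nonneg _) hφm
    fun x θ => abs_squeeze_sub_le h0 x θ).trans (ENNReal.ofReal_le_ofReal ?_)
  have : (1 / (n : ℝ)) ^ 2 ≤ 1 / n := by nlinarith
  have e : (3 : ℝ) / n = 3 * (1 / n) := by ring
  linarith

/-! ### Sensitivity of the empirical mean -/

theorem abs_empiricalMean_sub_le {n : ℕ} {X Y : Fin n → Bool} (h : hammingDist X Y ≤ 1) :
    |empiricalMean X - empiricalMean Y| ≤ 1 / n := by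
  rw [empiricalMean, empiricalMean, ← sub_div, abs_div, Nat.abs_cast]
  gcongr
  rw [← Finset.sum_sub_distrib]
  calc _ ≤ ∑ i, |(if X i then (1 : ℝ) else 0) - if Y i then 1 else 0| :=
        Finset.abs_sum_le_sum_abs _ _
    _ = ∑ i, if X i ≠ Y i then (1 : ℝ) else 0 :=
        Finset.sum_congr rfl fun i _ => by cases X i <;> cases Y i <;> simp
    _ = (hammingDist X Y : ℝ) := by simp [hammingDist, Finset.card_filter]
    _ ≤ 1 := by exact_mod_cast h

/-! ### The Laplace mechanism -/

theorem lintegral_exp_neg_abs_mul_pow (k : ℕ) :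
    ∫⁻ x : ℝ, ENNReal.ofReal (Real.exp (-|x|) / 2 * |x| ^ k) = ENNReal.ofReal (k.factorial) := by
  let f : ℝ → ℝ := fun x => Real.exp (-x) / 2 * x ^ k
  have hf : IntegrableOn f (Set.Ioi 0) := by
    have : IntegrableOn (fun x : ℝ => Real.exp (-x) * x ^ ((k + 1 : ℝ) - 1) / 2) (Set.Ioi 0) :=
      (Real.GammaIntegral_convergent (by positivity)).div_const 2
    refine this.congr_fun (fun x _ => ?_) measurableSet_Ioi
    simp [f]
    ring
  have hval : ∫ x in Set.Ioi (0 : ℝ), f x = (k.factorial : ℝ) / 2 := by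
    rw [← Real.Gamma_nat_eq_factorial, Real.Gamma_eq_integral (by positivity), ← integral_div]
    refine setIntegral_congr_fun measurableSet_Ioi fun x _ => ?_
    simp [f]
    ring
  have hint : Integrable fun x : ℝ => f |x| := by
    -- a function that is not integrable would have integral `0`, but this one has `k!`
    by_contra hni
    have h := integral_comp_abs (f := f)
    rw [integral_undef hni, hval] at h
    have : (0 : ℝ) < k.factorial := by exact_mod_cast k.factorial_pos
    linarith
  rw [← ofReal_integral_eq_lintegral_ofReal hint (ae_of_all _ fun x => by
    simp only [f]; positivity), integral_comp_abs, hval]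
  congr 1
  ring

instance isProbabilityMeasure_laplaceMeasure : IsProbabilityMeasure laplaceMeasure where
  measure_univ := by
    rw [laplaceMeasure, withDensity_apply _ .univ, Measure.restrict_univ]
    simpa using lintegral_exp_neg_abs_mul_pow 0

theorem lintegral_sq_laplaceMeasure :
    ∫⁻ z, ENNReal.ofReal (z ^ 2) ∂laplaceMeasure = ENNReal.ofReal 2 := by
  rw [laplaceMeasure, lintegral_withDensity_eq_lintegral_mul _ (by fun_prop) (by fun_prop)]
  have h := lintegral_exp_neg_abs_mul_pow 2
  simp only [Nat.factorial_two, Nat.cast_ofNat] at h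
  rw [← h]
  refine lintegral_congr fun x => ?_
  rw [Pi.mul_apply, ← ENNReal.ofReal_mul (by positivity), sq_abs]

/-- Translating the Laplace distribution by `h` changes probabilities by a factor of at most
`exp |h|`. -/
theorem laplaceMeasure_map_add_le (h : ℝ) {S : Set ℝ} (hS : MeasurableSet S) :
    laplaceMeasure ((fun z => z + h) ⁻¹' S) ≤
      ENNReal.ofReal (Real.exp |h|) * laplaceMeasure S := by
  have hm : Measurable fun z : ℝ => z + h := by fun_prop
  rw [laplaceMeasure, withDensity_apply _ (hm hS), withDensity_apply _ hS,
    ← lintegral_const_mul _ (by fun_prop), ← lintegral_indicator (hm hS),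
    ← lintegral_indicator hS,
    ← lintegral_add_right_eq_self
      (fun x => S.indicator (fun x => ENNReal.ofReal (Real.exp |h|) *
        ENNReal.ofReal (Real.exp (-|x|) / 2)) x) h]
  refine lintegral_mono fun z => ?_
  by_cases hz : z + h ∈ S
  · rw [Set.indicator_of_mem (by exact hz), Set.indicator_of_mem hz,
      ← ENNReal.ofReal_mul (Real.exp_pos _).le]
    refine ENNReal.ofReal_le_ofReal ?_
    rw [← mul_div_assoc, ← Real.exp_add]
    gcongr
    linarith [abs_add_le z h]
  · rw [Set.indicator_of_notMem (by exact hz)]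
    exact zero_le

theorem isDP_laplaceMechanism {n : ℕ} (hn : n ≠ 0) {ε : ℝ} (hε : 0 < ε) :
    IsDP ε 0 (laplaceMechanism n ε) := by
  intro X Y hXY S hS
  have hn' : (0 : ℝ) < n := by exact_mod_cast Nat.pos_of_ne_zero hn
  have hmeas (X : Fin n → Bool) : Measurable fun z : ℝ => empiricalMean X + 1 / (n * ε) * z := by
    fun_prop
  rw [ENNReal.ofReal_zero, add_zero, laplaceMechanism, additiveNoise_apply, additiveNoise_apply,
    Measure.map_apply (hmeas X) hS, Measure.map_apply (hmeas Y) hS]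
  set h : ℝ := (empiricalMean X - empiricalMean Y) * (n * ε) with hh
  have hle : |h| ≤ ε := by
    rw [hh, abs_mul, abs_of_pos (mul_pos hn' hε)]
    calc _ ≤ 1 / (n : ℝ) * (n * ε) := by gcongr; exact abs_empiricalMean_sub_le hXY
      _ = ε := by field_simp
  have e : (fun z : ℝ => empiricalMean X + 1 / (n * ε) * z) ⁻¹' S =
      (fun z => z + h) ⁻¹' ((fun z : ℝ => empiricalMean Y + 1 / (n * ε) * z) ⁻¹' S) := by
    rw [← Set.preimage_comp]
    congr 1
    funext z
    simp only [Function.comp, hh]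
    field_simp
    ring
  rw [e]
  refine (laplaceMeasure_map_add_le h (hmeas Y hS)).trans ?_
  gcongr

/-! ### The Gaussian mechanism -/

theorem lintegral_sq_gaussianReal :
    ∫⁻ z, ENNReal.ofReal (z ^ 2) ∂(gaussianReal 0 1) = ENNReal.ofReal 1 := by
  have hL : MemLp id 2 (gaussianReal 0 1) := memLp_id_gaussianReal 2
  have hv := variance_id_gaussianReal (μ := 0) (v := 1)
  rw [variance_of_integral_eq_zero (by fun_prop) (by simp)] at hv
  have hsq : Integrable (fun z : ℝ => z ^ 2) (gaussianReal 0 1) := hL.integrable_sq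
  rw [← ofReal_integral_eq_lintegral_ofReal hsq (ae_of_all _ fun x => sq_nonneg x)]
  simpa using congrArg ENNReal.ofReal hv

/-- The Rényi divergence of two normal distributions of the same variance: the power of the
likelihood ratio is the exponential of an affine function. -/
theorem renyiDiv_gaussianReal {α : ℝ} (hα : 1 < α) (m₁ m₂ : ℝ) {v : NNReal} (hv : v ≠ 0) :
    renyiDiv α (gaussianReal m₁ v) (gaussianReal m₂ v) =
      ((α * (m₁ - m₂) ^ 2 / (2 * v) : ℝ) : EReal) := by
  have hv' : (v : ℝ) ≠ 0 := by exact_mod_cast hv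
  let g : ℝ → ℝ≥0∞ := fun x =>
    ENNReal.ofReal (Real.exp (((x - m₂) ^ 2 - (x - m₁) ^ 2) / (2 * v)))
  have hg : Measurable g := by fun_prop
  have hd : gaussianReal m₁ v = (gaussianReal m₂ v).withDensity g := by
    rw [gaussianReal_of_var_ne_zero _ hv, gaussianReal_of_var_ne_zero _ hv,
      ← withDensity_mul _ (measurable_gaussianPDF _ _) hg]
    congr 1
    funext x
    rw [Pi.mul_apply, gaussianPDF, gaussianPDF,
      ← ENNReal.ofReal_mul (gaussianPDFReal_nonneg _ _ _), gaussianPDFReal, gaussianPDFReal,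
      mul_assoc _ (Real.exp _), ← Real.exp_add]
    congr 4
    ring
  have hac : gaussianReal m₁ v ≪ gaussianReal m₂ v := by
    rw [hd]
    exact withDensity_absolutelyContinuous _ _
  have hr : (gaussianReal m₁ v).rnDeriv (gaussianReal m₂ v) =ᵐ[gaussianReal m₁ v] g := by
    refine hac.ae_eq ?_
    conv_lhs => rw [hd]
    exact Measure.rnDeriv_withDensity _ hg
  let t : ℝ := (α - 1) * (m₁ - m₂) / v
  let b : ℝ := (α - 1) * (m₂ ^ 2 - m₁ ^ 2) / (2 * v)
  have hint : ∫⁻ x, (gaussianReal m₁ v).rnDeriv (gaussianReal m₂ v) x ^ (α - 1)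
      ∂(gaussianReal m₁ v) = ENNReal.ofReal (Real.exp (b + (m₁ * t + v * t ^ 2 / 2))) := by
    have e : ∫⁻ x, (gaussianReal m₁ v).rnDeriv (gaussianReal m₂ v) x ^ (α - 1)
        ∂(gaussianReal m₁ v) =
          ∫⁻ x, ENNReal.ofReal (Real.exp b * Real.exp (t * x)) ∂(gaussianReal m₁ v) := by
      refine lintegral_congr_ae ?_
      filter_upwards [hr] with x hx
      rw [hx, ENNReal.ofReal_rpow_of_pos (Real.exp_pos _), ← Real.exp_mul, ← Real.exp_add]
      congr 2
      simp only [t, b]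
      field_simp
      ring
    rw [e, ← ofReal_integral_eq_lintegral_ofReal
      ((integrable_exp_mul_gaussianReal t).const_mul _) (ae_of_all _ fun x => by positivity),
      integral_const_mul, Real.exp_add]
    congr 2
    exact congrFun mgf_fun_id_gaussianReal t
  rw [renyiDiv, if_pos hac, hint, ENNReal.log_ofReal_of_pos (Real.exp_pos _), Real.log_exp,
    ← EReal.coe_mul]
  congr 1
  have : α - 1 ≠ 0 := by linarith
  simp only [t, b]
  field_simp
  ring

theorem isZCDP_gaussianMechanism {n : ℕ} (hn : n ≠ 0) {ρ : ℝ} (hρ : 0 < ρ) :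
    IsZCDP ρ (gaussianMechanism n ρ) := by
  intro X Y hXY α hα
  have hn' : (0 : ℝ) < n := by exact_mod_cast Nat.pos_of_ne_zero hn
  have hs : 0 < √ρ := Real.sqrt_pos.2 hρ
  let v : NNReal := .mk ((2 / (n * √ρ)) ^ 2) (sq_nonneg _)
  have hv : v ≠ 0 := by
    have : (0 : ℝ) < v := by change (0 : ℝ) < (2 / (n * √ρ)) ^ 2; positivity
    exact_mod_cast this.ne'
  have law (X : Fin n → Bool) :
      gaussianMechanism n ρ X = gaussianReal (empiricalMean X) v := by
    have : (fun z : ℝ => empiricalMean X + 2 / (n * √ρ) * z) =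
      (fun y => empiricalMean X + y) ∘ fun z => 2 / (n * √ρ) * z := rfl
    rw [gaussianMechanism, additiveNoise_apply, this,
      ← Measure.map_map (by fun_prop) (by fun_prop), gaussianReal_map_const_mul,
      gaussianReal_map_const_add]
    simp [v]
  rw [law, law, renyiDiv_gaussianReal hα _ _ hv, EReal.coe_le_coe_iff]
  have hd := pow_le_pow_left₀ (abs_nonneg _) (abs_empiricalMean_sub_le hXY) 2
  rw [sq_abs] at hd
  calc α * (empiricalMean X - empiricalMean Y) ^ 2 / (2 * v)
      ≤ α * (1 / n) ^ 2 / (2 * v) := by gcongr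
    _ = ρ * α / 8 := by
        change α * (1 / n) ^ 2 / (2 * (2 / (n * √ρ)) ^ 2) = ρ * α / 8
        rw [div_pow 2, mul_pow, Real.sq_sqrt hρ.le]
        field_simp
        norm_num
    _ ≤ ρ * α := by nlinarith

/-! ### Minimax rates -/

/-- The lower bound for the minimax risk under a privacy condition that forces stability in total
variation. -/
theorem le_bernoulliMinimaxRisk {n : ℕ} (hn : 1 ≤ n) {κ τ : ℝ} (hκ : 0 < κ) (hτ : 0 < τ)
    (hκτ : κ ≤ n * τ) {O : Set ℝ} (C : Kernel (Fin n → Bool) O → Prop)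
    (hC : ∀ M : Kernel (Fin n → Bool) O, IsMarkovKernel M → C M →
      ∀ X Y, hammingDist X Y ≤ 1 → ∀ S : Set O, MeasurableSet S →
        (M X).real S ≤ (M Y).real S + τ) :
    ENNReal.ofReal (min (1 / 1024) (min (1 / 2) (κ / 4) ^ 2 / 16) *
        max (1 / (n : ℝ)) (1 / (n * τ) ^ 2)) ≤ bernoulliMinimaxRisk n O C :=
  le_iInf fun M => le_iInf fun hM => le_iInf fun hCM =>
    le_uniformRisk_of_stable hn hκ hτ hκτ M (hC M hM hCM)

end PrivateMinimax

theorem mainTheorem9 :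
    (∃ K : ℝ, 0 < K ∧ ∀ κ : ℝ, 0 < κ → ∃ k : ℝ, 0 < k ∧
      ∀ (n : ℕ) (ε : ℝ), 1 ≤ n → 0 < ε →
        -- the minimax risk, for every output set containing the parameter space `(0, 1)`
        (∀ O : Set ℝ, MeasurableSet O → Set.Ioo 0 1 ⊆ O →
          (κ ≤ n * ε →
            ENNReal.ofReal (k * max (1 / (n : ℝ)) (1 / (n * ε) ^ 2)) ≤
              PrivateMinimax.bernoulliMinimaxRisk n O (PrivateMinimax.IsDP ε 0)) ∧
          PrivateMinimax.bernoulliMinimaxRisk n O (PrivateMinimax.IsDP ε 0) ≤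
            ENNReal.ofReal (K * max (1 / (n : ℝ)) (1 / (n * ε) ^ 2))) ∧
        -- the Laplace mechanism is private and attains the rate
        IsMarkovKernel (PrivateMinimax.laplaceMechanism n ε) ∧
        PrivateMinimax.IsDP ε 0 (PrivateMinimax.laplaceMechanism n ε) ∧
        PrivateMinimax.bernoulliRisk n (PrivateMinimax.laplaceMechanism n ε) ≤
          ENNReal.ofReal (K * max (1 / (n : ℝ)) (1 / (n * ε) ^ 2))) ∧
    (∃ K : ℝ, 0 < K ∧ ∀ κ : ℝ, 0 < κ → ∃ k : ℝ, 0 < k ∧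
      ∀ (n : ℕ) (ρ : ℝ), 1 ≤ n → 0 < ρ →
        -- the minimax risk, for every output set containing the parameter space `(0, 1)`
        (∀ O : Set ℝ, MeasurableSet O → Set.Ioo 0 1 ⊆ O →
          (κ ≤ n * Real.sqrt ρ →
            ENNReal.ofReal (k * max (1 / (n : ℝ)) (1 / (n ^ 2 * ρ))) ≤
              PrivateMinimax.bernoulliMinimaxRisk n O (PrivateMinimax.IsZCDP ρ)) ∧
          PrivateMinimax.bernoulliMinimaxRisk n O (PrivateMinimax.IsZCDP ρ) ≤
            ENNReal.ofReal (K * max (1 / (n : ℝ)) (1 / (n ^ 2 * ρ)))) ∧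
        -- the Gaussian mechanism is private and attains the rate
        IsMarkovKernel (PrivateMinimax.gaussianMechanism n ρ) ∧
        PrivateMinimax.IsZCDP ρ (PrivateMinimax.gaussianMechanism n ρ) ∧
        PrivateMinimax.bernoulliRisk n (PrivateMinimax.gaussianMechanism n ρ) ≤
          ENNReal.ofReal (K * max (1 / (n : ℝ)) (1 / (n ^ 2 * ρ)))) := by
  refine ⟨⟨20, by norm_num, fun κ hκ =>
    ⟨min (1 / 1024) (min (1 / 2) (κ / 4) ^ 2 / 16), by positivity, fun n ε hn hε => ?_⟩⟩,
    ⟨20, by norm_num, fun κ hκ =>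
    ⟨min (1 / 1024) (min (1 / 2) (3 * κ / 4) ^ 2 / 16) / 9, by positivity, fun n ρ hn hρ => ?_⟩⟩⟩
  · have hn0 : n ≠ 0 := by omega
    have hn' : (0 : ℝ) < n := by exact_mod_cast hn
    have hle : (3 : ℝ) / n + 4 * (1 / (n * ε)) ^ 2 * 2 ≤
        20 * max (1 / (n : ℝ)) (1 / (n * ε) ^ 2) := by
      have h1 := le_max_left (1 / (n : ℝ)) (1 / (n * ε) ^ 2)
      have h2 := le_max_right (1 / (n : ℝ)) (1 / (n * ε) ^ 2)
      have e : (3 : ℝ) / n + 4 * (1 / (n * ε)) ^ 2 * 2 =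
        3 * (1 / (n : ℝ)) + 8 * (1 / (n * ε) ^ 2) := by ring
      have : 0 < 1 / (n : ℝ) := by positivity
      linarith
    have hdp := PrivateMinimax.isDP_laplaceMechanism hn0 hε
    refine ⟨fun O _ hO => ⟨fun h => ?_, ?_⟩, ?_, hdp, ?_⟩
    · exact PrivateMinimax.le_bernoulliMinimaxRisk hn hκ hε h _ fun M _ hM =>
        hM.real_le_add hε.le
    · exact (PrivateMinimax.bernoulliMinimaxRisk_le hn zero_le_two
        PrivateMinimax.lintegral_sq_laplaceMeasure.le _ hO _ fun φ hφ =>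
          PrivateMinimax.IsDP.map hdp hφ.measurable).trans (ENNReal.ofReal_le_ofReal hle)
    · exact PrivateMinimax.isMarkovKernel_additiveNoise _ _ _
    · refine (PrivateMinimax.bernoulliRisk_additiveNoise_le hn0 zero_le_two
        PrivateMinimax.lintegral_sq_laplaceMeasure.le _).trans
        (ENNReal.ofReal_le_ofReal (le_trans ?_ hle))
      gcongr
      norm_num
  · have hn0 : n ≠ 0 := by omega
    have hn' : (0 : ℝ) < n := by exact_mod_cast hn
    have hs : 0 < √ρ := Real.sqrt_pos.2 hρ
    have hle : (3 : ℝ) / n + 4 * (2 / (n * √ρ)) ^ 2 * 1 ≤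
        20 * max (1 / (n : ℝ)) (1 / (n ^ 2 * ρ)) := by
      have h1 := le_max_left (1 / (n : ℝ)) (1 / (n ^ 2 * ρ))
      have h2 := le_max_right (1 / (n : ℝ)) (1 / (n ^ 2 * ρ))
      have e : (3 : ℝ) / n + 4 * (2 / (n * √ρ)) ^ 2 * 1 =
          3 * (1 / (n : ℝ)) + 16 * (1 / (n ^ 2 * ρ)) := by
        rw [div_pow, mul_pow, Real.sq_sqrt hρ.le]
        ring
      have : 0 < 1 / (n : ℝ) := by positivity
      linarith
    have hdp := PrivateMinimax.isZCDP_gaussianMechanism hn0 hρ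
    have hmk : IsMarkovKernel (PrivateMinimax.gaussianMechanism n ρ) :=
      PrivateMinimax.isMarkovKernel_additiveNoise _ _ _
    refine ⟨fun O _ hO => ⟨fun h => ?_, ?_⟩, hmk, hdp, ?_⟩
    · -- the stability parameter is `3 * √ρ`, which costs a factor `9` in the rate
      refine le_trans (ENNReal.ofReal_le_ofReal ?_)
        (PrivateMinimax.le_bernoulliMinimaxRisk hn (κ := 3 * κ) (τ := 3 * √ρ) (by positivity)
          (by positivity) (by linarith) _ fun M _ hM X Y hXY S hS =>
            PrivateMinimax.real_le_add_of_renyiDiv_two_le hρ (hM X Y hXY 2 one_lt_two) hS)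
      rw [div_mul_eq_mul_div, mul_div_assoc]
      gcongr
      rw [div_le_iff₀ (by norm_num), max_mul_of_nonneg _ _ (by norm_num : (0 : ℝ) ≤ 9)]
      refine max_le_max ?_ (le_of_eq ?_)
      · have : 0 < 1 / (n : ℝ) := by positivity
        linarith
      · rw [mul_pow, mul_pow, Real.sq_sqrt hρ.le]
        field_simp
        norm_num
    · exact (PrivateMinimax.bernoulliMinimaxRisk_le hn zero_le_one
        PrivateMinimax.lintegral_sq_gaussianReal.le _ hO _ fun φ hφ =>
          PrivateMinimax.IsZCDP.map (M := PrivateMinimax.gaussianMechanism n ρ) hdp hφ).trans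
        (ENNReal.ofReal_le_ofReal hle)
    · refine (PrivateMinimax.bernoulliRisk_additiveNoise_le hn0 zero_le_one
        PrivateMinimax.lintegral_sq_gaussianReal.le _).trans
        (ENNReal.ofReal_le_ofReal (le_trans ?_ hle))
      gcongr
      norm_num
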